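/- For a real Hilbert space $\mathcal K$, let $\Gamma_0(\mathcal K)$ be the class of lower semicontinuous convex functions $f\colon\mathcal K\to\left]-\infty,+\infty\right]$ such that $\operatorname{dom} f=\{x\in\mathcal K : f(x)<+\infty\}\neq\varnothing$. Denote by $f^*\colon x^*\mapsto\sup_{x\in\mathcal K}(\langle x, x^*\rangle-f(x))$ the conjugate of $f$, by $\partial f\colon x\mapsto\{x^* : (\forall y\in\mathcal K)\ \langle y-x, x^*\rangle+f(x)\le f(y)\}$ its subdifferential, by $\operatorname{epi} f=\{(x,\xi)\in\mathcal K\times\mathbb R : f(x)\le\xi\}$ its epigraph, and by $(f\,\square\,h)(x)=\inf_{y\in\mathcal K}(f(y)+h(x-y))$ the infimal convolution of $f$ and $h$. For $C\subset\mathcal K$ convex, $x\in\operatorname{sri} C$ means that $x\in C$ and that $\bigcup_{\lambda>0}\lambda(C-x)$ is a closed vector subspace of $\mathcal K$; if $\mathcal K$ is finite-dimensional, $\operatorname{ri} C$ is the interior of $C$ relative to its affine hull, and $f$ is polyhedral if $\operatorname{epi} f$ is a finite intersection of closed half-spaces. Let $(\mathcal H_i)_{i\in I}$ and $(\mathcal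 G_k)_{k\in K}$ be finite families of real Hilbert spaces, with Hilbert direct sums $\boldsymbol{\mathcal H}=\bigoplus_{i\in I}\mathcal H_i$ and $\boldsymbol{\mathcal G}=\bigoplus_{k\in K}\mathcal G_k$. For every $i\in I$ and every $k\in K$, let $f_i\in\Gamma_0(\mathcal H_i)$, let $\alpha_i\in\left]0,+\infty\right[$, let $\varphi_i\colon\mathcal H_i\to\mathbb R$ be convex and differentiable with a $(1/\alpha_i)$-Lipschitzian gradient, let $g_k\in\Gamma_0(\mathcal G_k)$ and $h_k\in\Gamma_0(\mathcal G_k)$, let $\beta_k\in\left]0,+\infty\right[$, let $\psi_k\colon\mathcal G_k\to\mathbb R$ be convex and differentiable with a $(1/\beta_k)$-Lipschitzian gradient, and let $L_{ki}\colon\mathcal H_i\to\mathcal G_k$ be a bounded linear operator. Let $\chi\in\left[0,+\infty\right[$ and let $\Theta\colon\boldsymbol{\mathcal H}\to\mathbb R$ be convex and differentiable with a $\chi$-Lipschitzian gradient; denote by $\nabla_{\!i}\Theta$ its partial gradient relative to $\mathcal H_i$. Suppose that there exist $\widetilde{\boldsymbol x}=(\widetilde x_i)_{i\in I}\in\boldsymbol{\mathcal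 H}$ and $\widetilde{\boldsymbol v}^*=(\widetilde v_k^*)_{k\in K}\in\boldsymbol{\mathcal G}$ such that, for every $i\in I$ and every $k\in K$, $$-\sum_{j\in K}L_{ji}^*\widetilde v_j^*\in\partial f_i(\widetilde x_i)+\nabla\varphi_i(\widetilde x_i)+\nabla_{\!i}\Theta(\widetilde{\boldsymbol x}) \quad\text{and}\quad \sum_{j\in I}L_{kj}\widetilde x_j\in\partial(g_k^*\,\square\,\psi_k^*)(\widetilde v_k^*)+\partial h_k^*(\widetilde v_k^*),$$ and that, for every $k\in K$, one of the following is satisfied: (a) $0\in\operatorname{sri}(\operatorname{dom} g_k^*+\operatorname{dom}\psi_k^*-\operatorname{dom} h_k^*)$. (b) $\mathcal G_k$ is finite-dimensional, $h_k$ is polyhedral, and $\operatorname{dom} h_k^*\cap\operatorname{ri}\operatorname{dom}(g_k+\psi_k)^*\neq\varnothing$. (c) $\mathcal G_k$ is finite-dimensional, $g_k$ and $h_k$ are polyhedral, and $\psi_k=0$. Then, for every $k\in K$, the set $\operatorname{epi}(g_k+\psi_k)+\operatorname{epi} h_k$ is closed in $\mathcal G_k\times\mathbb R$. -/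

import Mathlib

open scoped Pointwise NNReal

noncomputable section

namespace ConvexSaddle

/-- The effective domain of an extended-real-valued function. -/
def dom {E : Type*} (f : E → EReal) : Set E :=
  {x | f x < ⊤}

/-- The epigraph of an extended-real-valued function. -/
def epi {E : Type*} (f : E → EReal) : Set (E × ℝ) :=
  {p | f p.1 ≤ (p.2 : EReal)}

/-- The infimal convolution of two functions with values in `]-∞, +∞]`. -/
def infConv {E : Type*} [AddCommGroup E] (f h : E → EReal) : E → EReal :=
  fun x => ⨅ y : E, f y + h (x - y)

section Hilbert

variable {E : Type*} [NormedAddCommGroup E] [InnerProductSpace ℝ E]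

/-- The class of lower semicontinuous convex functions with values in `]-∞, +∞]` and nonempty
effective domain. -/
structure IsGammaZero (f : E → EReal) : Prop where
  convex_epi : Convex ℝ (epi f)
  lowerSemicontinuous : LowerSemicontinuous f
  ne_bot : ∀ x, f x ≠ ⊥
  dom_nonempty : (dom f).Nonempty

/-- The (Legendre–Fenchel) conjugate. -/
def conj (f : E → EReal) : E → EReal :=
  fun u => ⨆ x : E, ((inner ℝ x u : ℝ) : EReal) - f x

/-- The subdifferential. -/
def subdiff (f : E → EReal) (x : E) : Set E :=
  {u | ∀ y : E, ((inner ℝ (y - x) u : ℝ) : EReal) + f x ≤ f y}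

/-- The strong relative interior: the points `x` of `C` such that the cone generated by `C - x`
is a closed vector subspace. -/
def sri (C : Set E) : Set E :=
  {x | x ∈ C ∧ ∃ V : Submodule ℝ E, IsClosed (V : Set E) ∧
    (⋃ (c : ℝ) (_ : 0 < c), c • (C - {x})) = (V : Set E)}

/-- A function is polyhedral if its epigraph is the intersection of finitely many closed
half-spaces. -/
def IsPolyhedral (f : E → EReal) : Prop :=
  ∃ (n : ℕ) (a : Fin n → (E × ℝ →L[ℝ] ℝ)) (b : Fin n → ℝ),
    epi f = {p | ∀ j, a j p ≤ b j}

end Hilbert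

/-- The partial gradient, relative to the `i`-th variable, of a function on a Hilbert direct
sum. -/
def partialGradient {I : Type*} [Fintype I] {H : I → Type*} [∀ i, NormedAddCommGroup (H i)]
    [∀ i, InnerProductSpace ℝ (H i)] [∀ i, CompleteSpace (H i)]
    (Θ : PiLp 2 H → ℝ) (i : I) (x : PiLp 2 H) : H i :=
  open scoped Classical in
  gradient (fun t : H i => Θ (WithLp.toLp 2 (Function.update (fun j => x j) i t))) (x i)

end ConvexSaddle

end

open ConvexSaddle

/-! A point `p` lies in `dom (conj f)` exactly when `p` is the slope of an affine minorant of `f`,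
so the qualification conditions are statements about the slopes of `A = epi (g + ψ)` and `B = epi
h`. Let `a n + b n` converge. A slope `p` of `A` and a slope `q` of `B` bound `⟪a n, p - q⟫` from
above. If nonnegative multiples of such differences fill a closed subspace `V` containing the first
components of `A`, then Banach–Steinhaus bounds `a n`, and a weak limit finishes, closed convex sets
being weakly closed (`isClosed_add_of_slopes_of_subset`). The directions in `Vᗮ` are harmless: `A`
absorbs them by Hahn–Banach (`add_mem_of_inner_slopes_eq`), so they can be moved onto `B`
(`isClosed_add_of_slopes`). In (a), `V` is the cone in the definition of `sri`; in (b), the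
direction of the affine span of the slopes of `A`; (c) is Fourier–Motzkin elimination. -/

noncomputable section

open Filter Topology

namespace ConvexSaddle

/-! ### Weak compactness and closedness of sums -/

section Weak

variable {E : Type*} [NormedAddCommGroup E] [InnerProductSpace ℝ E] [CompleteSpace E]

/-- A bounded family in a Hilbert space converges weakly along every ultrafilter. -/
theorem exists_weak_limit {ι : Type*} (U : Ultrafilter ι) (x : ι → E) {R : ℝ}
    (hx : ∀ n, ‖x n‖ ≤ R) :
    ∃ x₀ : E, ∀ v : E, Tendsto (fun n => (inner ℝ (x n) v : ℝ)) U (𝓝 (inner ℝ x₀ v)) := by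
  let D : ι → WeakDual ℝ E := fun n => StrongDual.toWeakDual (innerSL ℝ (x n))
  have hc := WeakDual.isCompact_closedBall (𝕜 := ℝ) (E := E) 0 R
  have hm : ∀ n, D n ∈ WeakDual.toStrongDual ⁻¹' Metric.closedBall (0 : StrongDual ℝ E) R := by
    intro n
    simp only [Set.mem_preimage, mem_closedBall_zero_iff]
    change ‖innerSL ℝ (x n)‖ ≤ R
    rw [innerSL_apply_norm]
    exact hx n
  obtain ⟨d, -, hd⟩ := hc.ultrafilter_le_nhds (U.map D)
    (le_principal_iff.2 (Ultrafilter.mem_map.2 (Filter.univ_mem' hm)))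
  refine ⟨(InnerProductSpace.toDual ℝ E).symm (WeakDual.toStrongDual d), fun v => ?_⟩
  rw [InnerProductSpace.toDual_symm_apply]
  have h1 : Tendsto D U (𝓝 d) := hd
  exact ((WeakDual.eval_continuous v).tendsto d).comp h1

/-- A continuous linear functional on `E × ℝ` is a pair of a vector and a real number. -/
theorem exists_prod_functional_eq (f : E × ℝ →L[ℝ] ℝ) :
    ∃ (u : E) (s : ℝ), ∀ p : E × ℝ, f p = inner ℝ p.1 u + s * p.2 := by
  refine ⟨(InnerProductSpace.toDual ℝ E).symm (f.comp (ContinuousLinearMap.inl ℝ E ℝ)),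
    f (0, 1), fun p => ?_⟩
  rw [real_inner_comm, InnerProductSpace.toDual_symm_apply]
  have h : p = (p.1, 0) + p.2 • ((0 : E), (1 : ℝ)) := by ext <;> simp
  conv_lhs => rw [h, map_add, map_smul]
  simp [mul_comm]

/-- A closed convex subset of `E × ℝ` is closed under weak limits. -/
theorem mem_of_weak_limit {ι : Type*} {l : Filter ι} [l.NeBot] {A : Set (E × ℝ)}
    (hA : IsClosed A) (hAc : Convex ℝ A) {x : ι → E} {ξ : ι → ℝ} (hx : ∀ n, (x n, ξ n) ∈ A)
    {x₀ : E} {ξ₀ : ℝ} (hx₀ : ∀ v : E, Tendsto (fun n => (inner ℝ (x n) v : ℝ)) l (𝓝 (inner ℝ x₀ v)))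
    (hξ₀ : Tendsto ξ l (𝓝 ξ₀)) : (x₀, ξ₀) ∈ A := by
  by_contra hn
  obtain ⟨f, r, h1, h2⟩ := geometric_hahn_banach_point_closed hAc hA hn
  obtain ⟨u, s, hf⟩ := exists_prod_functional_eq f
  have ht : Tendsto (fun n => f (x n, ξ n)) l (𝓝 (f (x₀, ξ₀))) := by
    simp only [hf]
    exact (hx₀ u).add (hξ₀.const_mul s)
  have := ge_of_tendsto' ht (fun n => (h2 _ (hx n)).le)
  linarith

/-- The slopes of the affine functions which minorize a subset of `E × ℝ`. -/
def minorantSlopes (A : Set (E × ℝ)) : Set E :=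
  {p | ∃ M : ℝ, ∀ a ∈ A, (inner ℝ a.1 p : ℝ) - a.2 ≤ M}

theorem isClosed_add_of_slopes_of_subset {A B : Set (E × ℝ)} (hA : IsClosed A) (hAc : Convex ℝ A)
    (hB : IsClosed B) (hBc : Convex ℝ B) (V : Submodule ℝ E) [V.HasOrthogonalProjection]
    (hAV : ∀ a ∈ A, a.1 ∈ V)
    (hV : ∀ v ∈ V, ∃ c : ℝ, 0 ≤ c ∧ ∃ p ∈ minorantSlopes A, ∃ q ∈ minorantSlopes B,
      v = c • (p - q)) : IsClosed (A + B) := by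
  refine isClosed_of_closure_subset fun z hz => ?_
  obtain ⟨s, hs, hsz⟩ := mem_closure_iff_seq_limit.1 hz
  choose a ha b hb hab using hs
  have hab1 : ∀ n, (a n).1 + (b n).1 = (s n).1 := fun n => by rw [← hab n]; rfl
  have hab2 : ∀ n, (a n).2 + (b n).2 = (s n).2 := fun n => by rw [← hab n]; rfl
  have hs1 : Tendsto (fun n => (s n).1) atTop (𝓝 z.1) := (continuous_fst.tendsto z).comp hsz
  have hs2 : Tendsto (fun n => (s n).2) atTop (𝓝 z.2) := (continuous_snd.tendsto z).comp hsz
  obtain ⟨S1, hS1⟩ := (Metric.isBounded_range_of_tendsto _ hs1).exists_norm_le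
  obtain ⟨S2, hS2⟩ := (Metric.isBounded_range_of_tendsto _ hs2).exists_norm_le
  replace hS1 : ∀ n, ‖(s n).1‖ ≤ S1 := fun n => hS1 _ ⟨n, rfl⟩
  replace hS2 : ∀ n, |(s n).2| ≤ S2 := fun n => hS2 _ ⟨n, rfl⟩
  have habs : ∀ (x v : E) (r : ℝ), ‖x‖ ≤ r → |(inner ℝ x v : ℝ)| ≤ r * ‖v‖ := fun x v r h =>
    (abs_real_inner_le_norm x v).trans (mul_le_mul_of_nonneg_right h (norm_nonneg v))
  -- Since `a n = s n - b n`, the term `-⟪a n, q⟫` is `⟪b n, q⟫ - ⟪s n, q⟫`; the two minorants then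
  -- leave only `(a n).2 + (b n).2 = (s n).2`, which is bounded.
  have upper : ∀ v ∈ V, ∃ C : ℝ, ∀ n, (inner ℝ (a n).1 v : ℝ) ≤ C := by
    intro v hv
    obtain ⟨c, hc, p, ⟨M, hM⟩, q, ⟨M', hM'⟩, rfl⟩ := hV v hv
    refine ⟨c * (M + M' + S2 + S1 * ‖q‖), fun n => ?_⟩
    rw [inner_smul_right, inner_sub_right]
    refine mul_le_mul_of_nonneg_left ?_ hc
    have h1 := hM _ (ha n)
    have h2 := hM' _ (hb n)
    have h3 := abs_le.1 (habs _ q _ (hS1 n))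
    have h4 := abs_le.1 (hS2 n)
    rw [← hab1 n, inner_add_left] at h3
    rw [← hab2 n] at h4
    linarith [h3.1, h3.2, h4.1, h4.2]
  have bdd : ∀ v : E, ∃ C : ℝ, ∀ n, ‖innerSL ℝ (a n).1 v‖ ≤ C := by
    intro v
    obtain ⟨C, hC⟩ := upper (V.starProjection v) (V.starProjection_apply_mem v)
    obtain ⟨C', hC'⟩ := upper (-V.starProjection v) (V.neg_mem (V.starProjection_apply_mem v))
    refine ⟨max C C', fun n => ?_⟩
    have h1 : (inner ℝ (a n).1 v : ℝ) = inner ℝ (a n).1 (V.starProjection v) := by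
      conv_lhs => rw [← Submodule.starProjection_eq_self_iff.2 (hAV _ (ha n))]
      exact Submodule.inner_starProjection_left_eq_right V _ _
    have h2 := hC' n
    rw [inner_neg_right] at h2
    rw [innerSL_apply_apply, h1, Real.norm_eq_abs]
    exact abs_le.2 ⟨by linarith [le_max_right C C'], (hC n).trans (le_max_left _ _)⟩
  obtain ⟨R, hR⟩ := banach_steinhaus bdd
  replace hR : ∀ n, ‖(a n).1‖ ≤ R := fun n => by simpa [innerSL_apply_norm] using hR n
  have hR' : ∀ n, ‖(b n).1‖ ≤ S1 + R := fun n => by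
    rw [← add_sub_cancel_left (a n).1 (b n).1, hab1 n]
    exact (norm_sub_le _ _).trans (add_le_add (hS1 n) (hR n))
  -- The vector `0` serves only to produce one slope of each set.
  obtain ⟨c, -, p, ⟨M, hM⟩, q, ⟨M', hM'⟩, -⟩ := hV 0 V.zero_mem
  have lowA : ∀ n, -(M + R * ‖p‖) ≤ (a n).2 := fun n => by
    linarith [hM _ (ha n), (abs_le.1 (habs _ p _ (hR n))).1]
  have lowB : ∀ n, -(M' + (S1 + R) * ‖q‖) ≤ (b n).2 := fun n => by
    linarith [hM' _ (hb n), (abs_le.1 (habs _ q _ (hR' n))).1]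
  have hupA : ∀ n, (a n).2 ≤ S2 + (M' + (S1 + R) * ‖q‖) := fun n => by
    linarith [lowB n, hab2 n, (abs_le.1 (hS2 n)).2]
  let U : Ultrafilter ℕ := Ultrafilter.of atTop
  have hU : (U : Filter ℕ) ≤ atTop := Ultrafilter.of_le _
  obtain ⟨x₀, hx₀⟩ := exists_weak_limit U (fun n => (a n).1) hR
  obtain ⟨ξ₀, -, hξ₀⟩ := isCompact_Icc.ultrafilter_le_nhds (U.map fun n => (a n).2)
    (le_principal_iff.2 (Ultrafilter.mem_map.2
      (Filter.univ_mem' fun n => Set.mem_Icc.2 ⟨lowA n, hupA n⟩)))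
  replace hξ₀ : Tendsto (fun n => (a n).2) U (𝓝 ξ₀) := hξ₀
  have memA : (x₀, ξ₀) ∈ A := mem_of_weak_limit hA hAc (fun n => ha n) hx₀ hξ₀
  have memB : (z.1 - x₀, z.2 - ξ₀) ∈ B := by
    refine mem_of_weak_limit hB hBc (l := (U : Filter ℕ)) (fun n => hb n) (fun v => ?_) ?_
    · have h1 : Tendsto (fun n => (inner ℝ (s n).1 v : ℝ)) U (𝓝 (inner ℝ z.1 v)) :=
        (hs1.mono_left hU).inner tendsto_const_nhds
      have h2 := h1.sub (hx₀ v)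
      rw [← inner_sub_left] at h2
      refine h2.congr fun n => ?_
      rw [← hab1 n, inner_add_left]; ring
    · refine ((hs2.mono_left hU).sub hξ₀).congr fun n => ?_
      rw [← hab2 n]; ring
  exact ⟨_, memA, _, memB, by ext <;> simp⟩

/-- A closed convex epigraph-like set is invariant along the directions which are constant on the
slopes of its affine minorants. -/
theorem add_mem_of_inner_slopes_eq {A : Set (E × ℝ)} (hA : IsClosed A) (hAc : Convex ℝ A)
    (hup : ∀ a ∈ A, ∀ t : ℝ, 0 ≤ t → (a.1, a.2 + t) ∈ A)
    (hne : (minorantSlopes A).Nonempty) {w : E} {c : ℝ}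
    (hw : ∀ p ∈ minorantSlopes A, (inner ℝ w p : ℝ) = c) {a : E × ℝ} (ha : a ∈ A) :
    a + (w, c) ∈ A := by
  by_contra hn
  obtain ⟨f, r, h1, h2⟩ := geometric_hahn_banach_closed_point hAc hA hn
  obtain ⟨u, s, hf⟩ := exists_prod_functional_eq f
  simp only [hf] at h1 h2
  have hs : s ≤ 0 := by
    by_contra! hs
    have h3 := h1 _ (hup a ha (|r - (inner ℝ a.1 u + s * a.2)| / s) (by positivity))
    have h4 : s * (|r - (inner ℝ a.1 u + s * a.2)| / s) = |r - (inner ℝ a.1 u + s * a.2)| := by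
      field_simp
    simp only [mul_add, h4] at h3
    linarith [le_abs_self (r - (inner ℝ a.1 u + s * a.2))]
  have h5 := h1 a ha
  simp only [Prod.fst_add, Prod.snd_add, inner_add_left] at h2
  -- If `s < 0`, rescaling the separating functional gives a slope. If `s = 0`, the hyperplane is
  -- vertical; adding `u` to any slope gives another slope, so `⟪w, u⟫ = 0`.
  rcases hs.lt_or_eq with hs | rfl
  · have hm : (-s)⁻¹ • u ∈ minorantSlopes A := by
      refine ⟨(-s)⁻¹ * r, fun b hb => ?_⟩
      have h6 := mul_le_mul_of_nonneg_left (h1 b hb).le (inv_nonneg.2 (neg_pos.2 hs).le)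
      rw [inner_smul_right]
      have h7 : (-s)⁻¹ * (s * b.2) = -b.2 := by
        rw [inv_neg, neg_mul, inv_mul_cancel_left₀ hs.ne]
      rw [mul_add, h7] at h6
      linarith
    have h8 := hw _ hm
    rw [inner_smul_right] at h8
    have h9 : (inner ℝ w u : ℝ) = -s * c := by
      rw [← h8, mul_inv_cancel_left₀ (neg_pos.2 hs).ne']
    rw [h9] at h2
    nlinarith
  · obtain ⟨p, M, hp⟩ := hne
    have hm : p + u ∈ minorantSlopes A := by
      refine ⟨M + r, fun b hb => ?_⟩
      have := h1 b hb
      have := hp b hb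
      rw [inner_add_right]
      linarith
    have h8 := hw _ hm
    rw [inner_add_right, hw p ⟨M, hp⟩] at h8
    simp only [zero_mul] at *
    linarith

/-- The graph of `w ↦ ⟪w, q⟫` over the orthogonal complement of `V`. -/
def orthogonalGraph (V : Submodule ℝ E) (q : E) : Submodule ℝ (E × ℝ) :=
  Vᗮ.map (LinearMap.prod LinearMap.id (innerSL ℝ q).toLinearMap)

omit [CompleteSpace E] in
theorem mem_orthogonalGraph {V : Submodule ℝ E} {q : E} {z : E × ℝ} :
    z ∈ orthogonalGraph V q ↔ z.1 ∈ Vᗮ ∧ z.2 = inner ℝ z.1 q := by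
  constructor
  · rintro ⟨w, hw, rfl⟩
    exact ⟨hw, by simp [real_inner_comm]⟩
  · rintro ⟨h1, h2⟩
    exact ⟨z.1, h1, by ext <;> simp [h2, real_inner_comm]⟩

/-- As `A` absorbs the graph over `Vᗮ`, the `Vᗮ`-component of each point of `A` can be transferred
to `B` without changing the sum, which reduces to the case where `A` lies over `V`. -/
theorem isClosed_add_of_slopes {A B : Set (E × ℝ)} (hA : IsClosed A) (hAc : Convex ℝ A)
    (hBc : Convex ℝ B) (V : Submodule ℝ E) (hVc : IsClosed (V : Set E)) (q : E)
    (hAN : ∀ a ∈ A, ∀ z ∈ orthogonalGraph V q, a + z ∈ A)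
    (hBN : IsClosed (B + (orthogonalGraph V q : Set (E × ℝ))))
    (hV : ∀ v ∈ V, ∃ c : ℝ, 0 ≤ c ∧ ∃ p ∈ minorantSlopes A,
      ∃ q' ∈ minorantSlopes (B + (orthogonalGraph V q : Set (E × ℝ))), v = c • (p - q')) :
    IsClosed (A + B) := by
  have : CompleteSpace V := hVc.completeSpace_coe
  have key : A + B = (A ∩ {a | a.1 ∈ V}) + (B + (orthogonalGraph V q : Set (E × ℝ))) := by
    apply Set.Subset.antisymm
    · rintro _ ⟨a, ha, b, hb, rfl⟩
      have hz : (a.1 - V.starProjection a.1, (inner ℝ (a.1 - V.starProjection a.1) q : ℝ)) ∈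
          orthogonalGraph V q :=
        mem_orthogonalGraph.2 ⟨V.sub_starProjection_mem_orthogonal a.1, rfl⟩
      refine ⟨a + -_, ⟨hAN a ha _ (neg_mem hz), ?_⟩, b + _, ⟨b, hb, _, hz, rfl⟩, by
        beta_reduce; abel⟩
      simp
    · rintro _ ⟨a, ⟨ha, -⟩, _, ⟨b, hb, z, hz, rfl⟩, rfl⟩
      exact ⟨a + z, hAN a ha z hz, b, hb, by beta_reduce; abel⟩
  rw [key]
  refine isClosed_add_of_slopes_of_subset (hA.inter (hVc.preimage continuous_fst))
    (hAc.inter (V.convex.linear_preimage (LinearMap.fst ℝ E ℝ)))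
    hBN (hBc.add (Submodule.convex _)) V (fun a ha => ha.2) fun v hv => ?_
  obtain ⟨c, hc, p, ⟨M, hM⟩, q', hq', rfl⟩ := hV v hv
  exact ⟨c, hc, p, ⟨M, fun a ha => hM a ha.1⟩, q', hq', rfl⟩

end Weak

/-! ### Polyhedra and Fourier–Motzkin elimination -/

section Polyhedral

variable {X : Type*} [AddCommGroup X] [Module ℝ X] [TopologicalSpace X]

/-- A finite intersection of closed half-spaces. -/
def IsPolyhedron (s : Set X) : Prop :=
  ∃ (ι : Type) (_ : Finite ι) (a : ι → (X →L[ℝ] ℝ)) (b : ι → ℝ), s = {p | ∀ j, a j p ≤ b j}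

theorem IsPolyhedron.isClosed {s : Set X} (hs : IsPolyhedron s) : IsClosed s := by
  obtain ⟨ι, _, a, b, rfl⟩ := hs
  rw [Set.ofPred_forall]
  exact isClosed_iInter fun j => isClosed_le (a j).continuous continuous_const

/-- Finitely many affine inequalities in one real unknown are solvable as soon as every pair of a
lower and an upper bound is compatible. -/
theorem exists_forall_mul_le {ι : Type*} [Finite ι] (e r : ι → ℝ)
    (h0 : ∀ j, e j = 0 → 0 ≤ r j)
    (h : ∀ j k, 0 < e j → e k < 0 → r k / e k ≤ r j / e j) :
    ∃ t : ℝ, ∀ j, t * e j ≤ r j := by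
  have := Fintype.ofFinite ι
  classical
  have main : ∃ t : ℝ, (∀ j, 0 < e j → t ≤ r j / e j) ∧ ∀ k, e k < 0 → r k / e k ≤ t := by
    by_cases hne : (Finset.univ.filter fun j => 0 < e j).Nonempty
    · obtain ⟨j, hj, hmin⟩ := Finset.exists_min_image _ (fun j => r j / e j) hne
      refine ⟨r j / e j, fun i hi => hmin i (by simpa using hi), fun k hk => ?_⟩
      exact h j k (by simpa using hj) hk
    · obtain ⟨t, ht⟩ := (Set.finite_range fun k => r k / e k).bddAbove
      refine ⟨t, fun j hj => (hne ⟨j, by simpa using hj⟩).elim, fun k _ => ht ⟨k, rfl⟩⟩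
  obtain ⟨t, h1, h2⟩ := main
  refine ⟨t, fun j => ?_⟩
  rcases lt_trichotomy (e j) 0 with hj | hj | hj
  · exact (div_le_iff_of_neg hj).1 (h2 j hj)
  · rw [hj, mul_zero]; exact h0 j hj
  · exact (le_div_iff₀ hj).1 (h1 j hj)

/-- Fourier–Motzkin elimination. -/
theorem IsPolyhedron.add_span_singleton [IsTopologicalAddGroup X] [ContinuousSMul ℝ X]
    {s : Set X} (hs : IsPolyhedron s) (e : X) :
    IsPolyhedron (s + (Submodule.span ℝ {e} : Set X)) := by
  obtain ⟨ι, _, a, b, rfl⟩ := hs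
  -- Keep the constraints that do not see `e`, and combine each upper bound on the coefficient of
  -- `e` with each lower bound.
  refine ⟨{j : ι // a j e = 0} ⊕ {j : ι // 0 < a j e} × {k : ι // a k e < 0}, inferInstance,
    Sum.elim (fun j => a j)
      (fun jk => (a jk.1 e)⁻¹ • a jk.1 - (a jk.2 e)⁻¹ • a jk.2),
    Sum.elim (fun j => b j) (fun jk => (a jk.1 e)⁻¹ * b jk.1 - (a jk.2 e)⁻¹ * b jk.2), ?_⟩
  ext x
  simp only [Set.mem_ofPred_eq, Sum.forall, Sum.elim_inl, Sum.elim_inr, Subtype.forall,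
    Prod.forall, sub_apply, smul_apply, smul_eq_mul]
  constructor
  · rintro ⟨y, hy, z, hz, rfl⟩
    obtain ⟨t, rfl⟩ := Submodule.mem_span_singleton.1 hz
    simp only [Set.mem_ofPred_eq] at hy
    refine ⟨fun j hj => by simpa [hj] using hy j, fun j hj k hk => ?_⟩
    have h1 := mul_le_mul_of_nonneg_left (hy j) (inv_nonneg.2 hj.le)
    have h2 := mul_le_mul_of_nonpos_left (hy k) (inv_nonpos.2 hk.le)
    simp only [map_add, map_smul, smul_eq_mul, mul_add]
    have h3 : (a j e)⁻¹ * (t * a j e) = t := by rw [mul_left_comm, inv_mul_cancel₀ hj.ne', mul_one]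
    have h4 : (a k e)⁻¹ * (t * a k e) = t := by rw [mul_left_comm, inv_mul_cancel₀ hk.ne, mul_one]
    rw [h3, h4]
    linarith
  · rintro ⟨h0, h1⟩
    obtain ⟨t, ht⟩ := exists_forall_mul_le (fun j => a j e) (fun j => b j - a j x)
      (fun j hj => sub_nonneg.2 (h0 j hj)) (fun j k hj hk => by
        have := h1 j hj k hk
        rw [div_eq_inv_mul, div_eq_inv_mul, mul_sub, mul_sub]
        linarith)
    refine ⟨x + t • e, fun j => ?_, -(t • e),
      neg_mem (Submodule.smul_mem _ _ (Submodule.mem_span_singleton_self e)), by simp⟩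
    rw [map_add, map_smul, smul_eq_mul]
    linarith [ht j]

theorem IsPolyhedron.add_submodule [IsTopologicalAddGroup X] [ContinuousSMul ℝ X]
    {s : Set X} (hs : IsPolyhedron s) {N : Submodule ℝ X} (hN : N.FG) :
    IsPolyhedron (s + (N : Set X)) := by
  induction N, hN using Submodule.fg_induction generalizing s with
  | singleton e => exact hs.add_span_singleton e
  | sup N₁ N₂ _ _ h₁ h₂ =>
    rw [Submodule.coe_sup, ← add_assoc]
    exact h₂ (h₁ hs)

/-- The sum is the projection to the second factor of the polyhedron of pairs `(x, z)` with `x ∈ s`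
and `z - x ∈ t`; adding `X × 0` and slicing at `0` realizes this projection. -/
theorem IsPolyhedron.isClosed_add [IsTopologicalAddGroup X] [ContinuousSMul ℝ X]
    [FiniteDimensional ℝ X] {s t : Set X} (hs : IsPolyhedron s) (ht : IsPolyhedron t) :
    IsClosed (s + t) := by
  obtain ⟨ι, _, a, b, rfl⟩ := hs
  obtain ⟨κ, _, a', b', rfl⟩ := ht
  let F := ContinuousLinearMap.fst ℝ X X
  let S := ContinuousLinearMap.snd ℝ X X
  have hP : IsPolyhedron {p : X × X | (∀ j, a j p.1 ≤ b j) ∧ ∀ k, a' k (p.2 - p.1) ≤ b' k} :=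
    ⟨ι ⊕ κ, inferInstance, Sum.elim (fun j => (a j).comp F) (fun k => (a' k).comp (S - F)),
      Sum.elim b b', by ext; simp [F, S]⟩
  have hN : (LinearMap.range (LinearMap.inl ℝ X X)).FG := IsNoetherian.noetherian _
  convert (hP.add_submodule hN).isClosed.preimage
    (continuous_const.prodMk continuous_id : Continuous fun z : X => ((0 : X), z)) using 1
  ext z
  constructor
  · rintro ⟨x, hx, y, hy, rfl⟩
    refine ⟨(x, x + y), ⟨hx, by simpa using hy⟩, (-x, 0), ⟨-x, rfl⟩, by simp⟩
  · rintro ⟨⟨x, y⟩, ⟨hx, hy⟩, _, ⟨w, rfl⟩, hxy⟩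
    simp only [LinearMap.coe_inl, Prod.mk_add_mk, add_zero, Prod.mk.injEq] at hxy
    obtain ⟨-, rfl⟩ := hxy
    exact ⟨x, hx, y - x, hy, by simp⟩

end Polyhedral

/-! ### Epigraphs, conjugates and the qualification conditions -/

section Epigraph

variable {E : Type*} [NormedAddCommGroup E] [InnerProductSpace ℝ E]

omit [InnerProductSpace ℝ E] in
theorem isClosed_epi {f : E → EReal} (hf : LowerSemicontinuous f) : IsClosed (epi f) :=
  hf.isClosed_epigraph.preimage
    (continuous_fst.prodMk (continuous_coe_real_ereal.comp continuous_snd))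

theorem epi_add_mem {X : Type*} {f : X → EReal} {a : X × ℝ} (ha : a ∈ epi f) (t : ℝ)
    (ht : 0 ≤ t) : (a.1, a.2 + t) ∈ epi f :=
  le_trans (α := EReal) ha (EReal.coe_le_coe_iff.2 (by simpa using ht))

theorem dom_conj {f : E → EReal} (hf : ∀ x, f x ≠ ⊥) : dom (conj f) = minorantSlopes (epi f) := by
  ext p
  constructor
  · intro hp
    obtain ⟨M, hM⟩ : ∃ M : ℝ, conj f p ≤ M := by
      rcases eq_or_ne (conj f p) ⊥ with h | h
      · exact ⟨0, by simp [h]⟩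
      · exact ⟨(conj f p).toReal, (EReal.coe_toReal (ne_of_lt hp) h).ge⟩
    refine ⟨M, fun a ha => ?_⟩
    have h1 : ((inner ℝ a.1 p : ℝ) : EReal) - f a.1 ≤ M :=
      (le_iSup (fun x : E => ((inner ℝ x p : ℝ) : EReal) - f x) a.1).trans hM
    have h2 : ((inner ℝ a.1 p : ℝ) : EReal) - (a.2 : EReal) ≤ M :=
      (EReal.sub_le_sub le_rfl ha).trans h1
    exact_mod_cast h2
  · rintro ⟨M, hM⟩
    refine lt_of_le_of_lt (iSup_le fun x => ?_) (EReal.coe_lt_top M)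
    rcases eq_or_ne (f x) ⊤ with h | h
    · simp [h]
    · have hx := EReal.coe_toReal h (hf x)
      have h1 := hM (x, (f x).toReal) hx.ge
      rw [← hx]
      exact_mod_cast h1

theorem mem_epi_add_coe {X : Type*} {g : X → EReal} {ψ : X → ℝ} {a : X × ℝ} :
    a ∈ epi (fun y => g y + (ψ y : EReal)) ↔ (a.1, a.2 - ψ a.1) ∈ epi g := by
  change g a.1 + (ψ a.1 : EReal) ≤ (a.2 : EReal) ↔ g a.1 ≤ ((a.2 - ψ a.1 : ℝ) : EReal)
  rw [EReal.coe_sub, EReal.le_sub_iff_add_le (by simp) (by simp)]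

theorem mem_epi_coe {X : Type*} {ψ : X → ℝ} {a : X × ℝ} :
    a ∈ epi (fun y => (ψ y : EReal)) ↔ ψ a.1 ≤ a.2 :=
  EReal.coe_le_coe_iff

omit [InnerProductSpace ℝ E] in
theorem isClosed_epi_add_coe {g : E → EReal} (hg : LowerSemicontinuous g) {ψ : E → ℝ}
    (hψ : Continuous ψ) : IsClosed (epi fun y => g y + (ψ y : EReal)) := by
  have h : (epi fun y => g y + (ψ y : EReal)) =
      (fun a : E × ℝ => (a.1, a.2 - ψ a.1)) ⁻¹' epi g := by
    ext a; exact mem_epi_add_coe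
  rw [h]
  exact (isClosed_epi hg).preimage (by fun_prop)

theorem convex_epi_add_coe {g : E → EReal} (hg : Convex ℝ (epi g)) {ψ : E → ℝ}
    (hψ : ConvexOn ℝ Set.univ ψ) : Convex ℝ (epi fun y => g y + (ψ y : EReal)) := by
  intro a ha b hb s t hs ht hst
  rw [mem_epi_add_coe] at *
  have h1 := hg ha hb hs ht hst
  have h2 := hψ.2 (Set.mem_univ a.1) (Set.mem_univ b.1) hs ht hst
  simp only [smul_eq_mul] at h2
  convert epi_add_mem h1 (s * ψ a.1 + t * ψ b.1 - ψ (s • a.1 + t • b.1)) (by linarith) using 1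
  ext
  · simp
  · simp; ring

theorem convex_epi_coe {ψ : E → ℝ} (hψ : ConvexOn ℝ Set.univ ψ) :
    Convex ℝ (epi fun y => (ψ y : EReal)) := by
  intro a ha b hb s t hs ht hst
  rw [mem_epi_coe] at *
  have h2 := hψ.2 (Set.mem_univ a.1) (Set.mem_univ b.1) hs ht hst
  simp only [smul_eq_mul] at h2
  simp only [Prod.fst_add, Prod.snd_add, Prod.smul_fst, Prod.smul_snd, smul_eq_mul]
  nlinarith

omit [InnerProductSpace ℝ E] in
theorem isClosed_epi_coe {ψ : E → ℝ} (hψ : Continuous ψ) :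
    IsClosed (epi fun y => (ψ y : EReal)) := by
  have h : (epi fun y => (ψ y : EReal)) = {a : E × ℝ | ψ a.1 ≤ a.2} := by
    ext a; exact mem_epi_coe
  rw [h]
  exact isClosed_le (by fun_prop) (by fun_prop)

theorem add_coe_ne_bot {X : Type*} {g : X → EReal} (hg : ∀ x, g x ≠ ⊥) (ψ : X → ℝ) (x : X) :
    g x + (ψ x : EReal) ≠ ⊥ := by
  simp [EReal.add_eq_bot_iff, hg x]

/-- Only this easy inclusion between slope sets is needed: the closedness criterion asks for enough
slopes, not all of them. -/
theorem add_mem_minorantSlopes {g : E → EReal} {ψ : E → ℝ} {p p' : E}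
    (hp : p ∈ minorantSlopes (epi g)) (hp' : p' ∈ minorantSlopes (epi fun y => (ψ y : EReal))) :
    p + p' ∈ minorantSlopes (epi fun y => g y + (ψ y : EReal)) := by
  obtain ⟨M, hM⟩ := hp
  obtain ⟨M', hM'⟩ := hp'
  refine ⟨M + M', fun a ha => ?_⟩
  have h1 := hM _ (mem_epi_add_coe.1 ha)
  have h2 := hM' (a.1, ψ a.1) (mem_epi_coe.2 le_rfl)
  simp only at h1 h2
  rw [inner_add_right]
  linarith

theorem isPolyhedron_epi {f : E → EReal} (hf : IsPolyhedral f) : IsPolyhedron (epi f) := by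
  obtain ⟨n, a, b, h⟩ := hf
  exact ⟨Fin n, inferInstance, a, b, h⟩

/-- Attouch–Brezis qualification condition. -/
theorem isClosed_epi_add_of_sri [CompleteSpace E] {g h : E → EReal} (hg : IsGammaZero g)
    (hh : IsGammaZero h) {ψ : E → ℝ} (hψ : ConvexOn ℝ Set.univ ψ) (hψc : Continuous ψ)
    (hQ : (0 : E) ∈ sri (dom (conj g) + dom (conj fun y => (ψ y : EReal)) - dom (conj h))) :
    IsClosed (epi (fun y => g y + (ψ y : EReal)) + epi h) := by
  rw [dom_conj hg.ne_bot, dom_conj hh.ne_bot, dom_conj (fun x => EReal.coe_ne_bot _)] at hQ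
  obtain ⟨⟨_, ⟨p₀, hp₀, p₀', hp₀', rfl⟩, q₀, hq₀, h0⟩, V, hVc, hV⟩ := hQ
  have h0 : p₀ + p₀' - q₀ = 0 := h0
  have hmem : ∀ p ∈ minorantSlopes (epi g),
      ∀ p' ∈ minorantSlopes (epi fun y => (ψ y : EReal)), ∀ q ∈ minorantSlopes (epi h),
      p + p' - q ∈ V := by
    intro p hp p' hp' q hq
    rw [← SetLike.mem_coe, ← hV]
    refine Set.mem_iUnion₂.2 ⟨1, one_pos, ?_⟩
    rw [one_smul]
    exact ⟨_, ⟨_, ⟨p, hp, p', hp', rfl⟩, q, hq, rfl⟩, 0, rfl, sub_zero _⟩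
  have horth : ∀ w ∈ Vᗮ, ∀ p ∈ minorantSlopes (epi g),
      ∀ p' ∈ minorantSlopes (epi fun y => (ψ y : EReal)), ∀ q ∈ minorantSlopes (epi h),
      (inner ℝ w p : ℝ) + inner ℝ w p' - inner ℝ w q = 0 := by
    intro w hw p hp p' hp' q hq
    rw [← inner_add_right, ← inner_sub_right]
    exact Submodule.inner_left_of_mem_orthogonal (hmem p hp p' hp' q hq) hw
  have hB : epi h + (orthogonalGraph V q₀ : Set (E × ℝ)) = epi h := by
    apply Set.Subset.antisymm
    · rintro _ ⟨b, hb, ⟨w, c⟩, hz, rfl⟩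
      obtain ⟨hw, hc⟩ := mem_orthogonalGraph.1 hz
      refine add_mem_of_inner_slopes_eq (isClosed_epi hh.lowerSemicontinuous) hh.convex_epi
        (fun _ => epi_add_mem) ⟨q₀, hq₀⟩ (fun q hq => ?_) hb
      have h1 := horth w hw p₀ hp₀ p₀' hp₀' q hq
      have h2 := horth w hw p₀ hp₀ p₀' hp₀' q₀ hq₀
      simp only at hc
      linarith
    · exact fun b hb => ⟨b, hb, 0, zero_mem _, add_zero b⟩
  refine isClosed_add_of_slopes (isClosed_epi_add_coe hg.lowerSemicontinuous hψc)
    (convex_epi_add_coe hg.convex_epi hψ) hh.convex_epi V hVc q₀ ?_ ?_ ?_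
  -- The condition controls slopes of `g` and `ψ` separately, while `g + ψ` may have others. Hence
  -- invariance is proved for each epigraph and then added, using `⟪w, q₀⟫ = ⟪w, p₀⟫ + ⟪w, p₀'⟫`.
  · rintro ⟨x, ξ⟩ ha ⟨w, c⟩ hz
    obtain ⟨hw, hc⟩ := mem_orthogonalGraph.1 hz
    simp only at hw hc
    have h2 := horth w hw p₀ hp₀ p₀' hp₀' q₀ hq₀
    have h3 := add_mem_of_inner_slopes_eq (isClosed_epi hg.lowerSemicontinuous) hg.convex_epi
      (fun _ => epi_add_mem) ⟨p₀, hp₀⟩ (w := w) (c := inner ℝ w p₀) (fun p hp => by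
        linarith [horth w hw p hp p₀' hp₀' q₀ hq₀]) (mem_epi_add_coe.1 ha)
    have h4 := add_mem_of_inner_slopes_eq (isClosed_epi_coe hψc) (convex_epi_coe hψ)
      (fun _ => epi_add_mem) ⟨p₀', hp₀'⟩ (w := w) (c := inner ℝ w p₀') (fun p hp => by
        linarith [horth w hw p₀ hp₀ p hp q₀ hq₀]) (a := (x, ψ x)) (mem_epi_coe.2 le_rfl)
    rw [mem_epi_coe] at h4
    simp only [Prod.mk_add_mk] at h3 h4
    rw [mem_epi_add_coe]
    convert epi_add_mem h3 (ψ x + inner ℝ w p₀' - ψ (x + w)) (by linarith) using 1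
    ext
    · simp
    · simp only [Prod.mk_add_mk]
      linarith
  · rw [hB]; exact isClosed_epi hh.lowerSemicontinuous
  · intro v hv
    rw [← SetLike.mem_coe, ← hV] at hv
    obtain ⟨c, hc, _, ⟨_, ⟨_, ⟨p, hp, p', hp', rfl⟩, q, hq, rfl⟩, _, rfl, rfl⟩, rfl⟩ :=
      Set.mem_iUnion₂.1 hv
    rw [hB]
    exact ⟨c, hc.le, p + p', add_mem_minorantSlopes hp hp', q, hq, by simp⟩

theorem exists_pos_add_smul_mem_of_mem_intrinsicInterior {D : Set E} {q v : E}
    (hq : q ∈ intrinsicInterior ℝ D) (hv : v ∈ (affineSpan ℝ D).direction) :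
    ∃ t : ℝ, 0 < t ∧ q + t • v ∈ D := by
  obtain ⟨⟨q, hqs⟩, hqi, rfl⟩ := mem_intrinsicInterior.1 hq
  have hline : ∀ t : ℝ, q + t • v ∈ affineSpan ℝ D := fun t => by
    rw [add_comm]
    exact AffineSubspace.vadd_mem_of_mem_direction (Submodule.smul_mem _ t hv) hqs
  let γ : ℝ → affineSpan ℝ D := fun t => ⟨q + t • v, hline t⟩
  have hγ : Continuous γ := by
    refine Continuous.subtype_mk ?_ _
    fun_prop
  have h0 : γ 0 = ⟨q, hqs⟩ := by simp [γ]
  have hU : γ ⁻¹' interior ((↑) ⁻¹' D) ∈ nhds (0 : ℝ) :=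
    (isOpen_interior.preimage hγ).mem_nhds (by rw [Set.mem_preimage, h0]; exact hqi)
  obtain ⟨ε, hε, hball⟩ := Metric.mem_nhds_iff.1 hU
  refine ⟨ε / 2, half_pos hε, ?_⟩
  have h1 : ε / 2 ∈ Metric.ball (0 : ℝ) ε := by
    rw [mem_ball_zero_iff, Real.norm_of_nonneg (half_pos hε).le]
    exact half_lt_self hε
  have h2 : γ (ε / 2) ∈ ((↑) ⁻¹' D : Set (affineSpan ℝ D)) := interior_subset (hball h1)
  exact h2

/-- The set `B` need not absorb the directions orthogonal to `V`; polyhedrality keeps it closed once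
they are added. -/
theorem isClosed_add_of_intrinsicInterior [FiniteDimensional ℝ E] {A B : Set (E × ℝ)}
    (hA : IsClosed A) (hAc : Convex ℝ A)
    (hup : ∀ a ∈ A, ∀ t : ℝ, 0 ≤ t → (a.1, a.2 + t) ∈ A) (hBc : Convex ℝ B)
    (hB : IsPolyhedron B)
    (hQ : (minorantSlopes B ∩ intrinsicInterior ℝ (minorantSlopes A)).Nonempty) :
    IsClosed (A + B) := by
  have : CompleteSpace E := FiniteDimensional.complete ℝ E
  obtain ⟨q, ⟨M, hM⟩, hq⟩ := hQ
  have hqA : q ∈ minorantSlopes A := intrinsicInterior_subset hq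
  refine isClosed_add_of_slopes hA hAc hBc (affineSpan ℝ (minorantSlopes A)).direction
    (Submodule.closed_of_finiteDimensional _) q ?_
    (hB.add_submodule (IsNoetherian.noetherian _)).isClosed ?_
  · rintro a ha ⟨w, c⟩ hz
    obtain ⟨hw, hc⟩ := mem_orthogonalGraph.1 hz
    simp only at hw hc
    refine add_mem_of_inner_slopes_eq hA hAc hup ⟨q, hqA⟩ (fun p hp => ?_) ha
    have h1 := Submodule.inner_left_of_mem_orthogonal (AffineSubspace.vsub_mem_direction
      (subset_affineSpan ℝ _ hp) (subset_affineSpan ℝ _ hqA)) hw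
    rw [vsub_eq_sub, inner_sub_right] at h1
    linarith
  · intro v hv
    obtain ⟨t, ht, hD⟩ := exists_pos_add_smul_mem_of_mem_intrinsicInterior hq hv
    refine ⟨t⁻¹, (inv_pos.2 ht).le, _, hD, q, ⟨M, ?_⟩, ?_⟩
    -- The slope `q` survives with the same `M`, because `⟪z.1, q⟫ - z.2` vanishes on the graph.
    · rintro _ ⟨b, hb, z, hz, rfl⟩
      have h1 := hM b hb
      have h2 := (mem_orthogonalGraph.1 hz).2
      simp only [Prod.fst_add, Prod.snd_add, inner_add_left]
      linarith
    · rw [add_sub_cancel_left, smul_smul, inv_mul_cancel₀ ht.ne', one_smul]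

end Epigraph

end ConvexSaddle

end

theorem proposition5
    {I K : Type*} [Fintype I] [Fintype K]
    {H : I → Type*} [∀ i, NormedAddCommGroup (H i)] [∀ i, InnerProductSpace ℝ (H i)]
    [∀ i, CompleteSpace (H i)]
    {G : K → Type*} [∀ k, NormedAddCommGroup (G k)] [∀ k, InnerProductSpace ℝ (G k)]
    [∀ k, CompleteSpace (G k)]
    (f : ∀ i, H i → EReal) (hf : ∀ i, IsGammaZero (f i))
    (α : I → ℝ≥0) (hα : ∀ i, 0 < α i)
    (φ : ∀ i, H i → ℝ) (hφ_convex : ∀ i, ConvexOn ℝ Set.univ (φ i))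
    (hφ_diff : ∀ i, Differentiable ℝ (φ i))
    (hφ_lip : ∀ i, LipschitzWith (1 / α i) (gradient (φ i)))
    (g : ∀ k, G k → EReal) (hg : ∀ k, IsGammaZero (g k))
    (h : ∀ k, G k → EReal) (hh : ∀ k, IsGammaZero (h k))
    (β : K → ℝ≥0) (hβ : ∀ k, 0 < β k)
    (ψ : ∀ k, G k → ℝ) (hψ_convex : ∀ k, ConvexOn ℝ Set.univ (ψ k))
    (hψ_diff : ∀ k, Differentiable ℝ (ψ k))
    (hψ_lip : ∀ k, LipschitzWith (1 / β k) (gradient (ψ k)))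
    (L : ∀ k i, H i →L[ℝ] G k)
    (χ : ℝ≥0) (Θ : PiLp 2 H → ℝ) (hΘ_convex : ConvexOn ℝ Set.univ Θ)
    (hΘ_diff : Differentiable ℝ Θ) (hΘ_lip : LipschitzWith χ (gradient Θ))
    (hKT : ∃ (x : PiLp 2 H) (v : PiLp 2 G),
      (∀ i, -∑ j, ContinuousLinearMap.adjoint (L j i) (v j) ∈
        subdiff (f i) (x i) + {gradient (φ i) (x i)} + {partialGradient Θ i x}) ∧
      (∀ k, ∑ j, L k j (x j) ∈
        subdiff (infConv (conj (g k)) (conj (fun y => (ψ k y : EReal)))) (v k) +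
          subdiff (conj (h k)) (v k)))
    (hQ : ∀ k,
      ((0 : G k) ∈ sri (dom (conj (g k)) + dom (conj (fun y => (ψ k y : EReal))) -
          dom (conj (h k)))) ∨
      (FiniteDimensional ℝ (G k) ∧ IsPolyhedral (h k) ∧
        (dom (conj (h k)) ∩
          intrinsicInterior ℝ (dom (conj (fun y => g k y + (ψ k y : EReal))))).Nonempty) ∨
      (FiniteDimensional ℝ (G k) ∧ IsPolyhedral (g k) ∧ IsPolyhedral (h k) ∧ ψ k = 0)) :
    ∀ k, IsClosed (epi (fun y => g k y + (ψ k y : EReal)) + epi (h k)) := by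
  intro k
  have hψc : Continuous (ψ k) := (hψ_diff k).continuous
  rcases hQ k with hQ | ⟨_, hpol, hQ⟩ | ⟨_, hgpol, hhpol, hψ0⟩
  · exact isClosed_epi_add_of_sri (hg k) (hh k) (hψ_convex k) hψc hQ
  · rw [dom_conj (hh k).ne_bot, dom_conj (add_coe_ne_bot (hg k).ne_bot _)] at hQ
    exact isClosed_add_of_intrinsicInterior
      (isClosed_epi_add_coe (hg k).lowerSemicontinuous hψc)
      (convex_epi_add_coe (hg k).convex_epi (hψ_convex k)) (fun _ => epi_add_mem)
      (hh k).convex_epi (isPolyhedron_epi hpol) hQ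
  · have h0 : (fun y => g k y + (ψ k y : EReal)) = g k := by
      funext y
      simp [hψ0]
    rw [h0]
    exact (isPolyhedron_epi hgpol).isClosed_add (isPolyhedron_epi hhpol)
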